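/- **Setting.** Let $d\ge 2$, $B,L>0$, $\epsilon,\delta\ge 0$ with $\epsilon+\delta>0$. Let $\phi:\mathcal S\times\mathcal A\to\mathbb R^d$ satisfy $\|\phi(s,a)\|\le L$ for all $(s,a)$, fix queries $(s_i,a_i^0,a_i^1)$, $i=1,\dots,n$, and put $x_i=\phi(s_i,a_i^1)-\phi(s_i,a_i^0)$ (all norms are Euclidean). In the Bradley–Terry–Luce (BTL) model with parameter $\theta^*\in\Theta_B=\{\theta\in\mathbb R^d:\langle \mathbf 1,\theta\rangle=0,\ \|\theta\|\le B\}$ the labels $y_1,\dots,y_n\in\{0,1\}$ are independent and $$\Pr[y_i=l]=\frac{\exp(\phi(s_i,a_i^l)^\top\theta^*)}{\exp(\phi(s_i,a_i^0)^\top\theta^*)+\exp(\phi(s_i,a_i^1)^\top\theta^*)},\qquad l\in\{0,1\}.$$ An estimator is a randomized algorithm that maps a dataset $\mathcal D=(s_i,a_i^0,a_i^1,y_i)_{i\le n}$ to a random $\hat\theta(\mathcal D)\in\mathbb R^d$. It is $(\epsilon,\delta)$-label DP in the central model if $\Pr[\hat\theta(\mathcal D)\in E]\le e^{\epsilon}\Pr[\hat\theta(\mathcal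 D')\in E]+\delta$ for all measurable $E\subseteq\mathbb R^d$ and all datasets $\mathcal D,\mathcal D'$ that differ only in the label of one sample. **Theorem.** There are universal constants $c,C>0$ such that the following holds in this setting for all sufficiently large $n$, namely whenever $$n\ \ge\ C\,\frac{d^2}{L^2B^2},\qquad n\ \ge\ C\,\frac{\sqrt d}{B(\epsilon+\delta)},$$ and, in the remaining case that $B<1$ and $\|x_i\|>\sqrt d$ for some $i$, also $n\ge \frac{L^2}{d(\epsilon+\delta)^2}$. For every estimator $\hat\theta$ that is $(\epsilon,\delta)$-label DP in the central model there is a parameter $\theta^*\in\Theta_B$ such that, when the labels are drawn from the BTL model with parameter $\theta^*$, $$\mathbb E\,\|\hat\theta-\theta^*\|_2^2\ \ge\ c\left(\frac{d^2}{nL^2}+\frac{d}{n^2(\epsilon+\delta)^2}\right).$$ -/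

import Mathlib

open MeasureTheory
open scoped ENNReal

/-- A comparison query: a state together with two candidate actions `a⁰` (`action false`) and
`a¹` (`action true`). -/
structure Query (S A : Type*) where
  state : S
  action : Bool → A

/-- A labelled dataset of `n` samples `(sᵢ, aᵢ⁰, aᵢ¹, yᵢ)`; the label `true` stands for `yᵢ = 1`. -/
abbrev Dataset (S A : Type*) (n : ℕ) := Fin n → Query S A × Bool

/-- The linear reward `φ(s, a)ᵀ θ`. -/
noncomputable def reward {S A : Type*} {d : ℕ} (φ : S → A → EuclideanSpace ℝ (Fin d))
    (θ : EuclideanSpace ℝ (Fin d)) (s : S) (a : A) : ℝ :=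
  inner ℝ (φ s a) θ

/-- The Bradley-Terry-Luce probability of the label `l` at the query `q` under the parameter `θ`. -/
noncomputable def btlProb {S A : Type*} {d : ℕ} (φ : S → A → EuclideanSpace ℝ (Fin d))
    (θ : EuclideanSpace ℝ (Fin d)) (q : Query S A) (l : Bool) : ℝ :=
  Real.exp (reward φ θ q.state (q.action l)) /
    (Real.exp (reward φ θ q.state (q.action false)) +
      Real.exp (reward φ θ q.state (q.action true)))

/-- The differential feature `x = φ(s, a¹) - φ(s, a⁰)` of a query. -/
noncomputable def diffFeature {S A : Type*} {d : ℕ} (φ : S → A → EuclideanSpace ℝ (Fin d))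
    (q : Query S A) : EuclideanSpace ℝ (Fin d) :=
  φ q.state (q.action true) - φ q.state (q.action false)

/-- The parameter set `Θ_B`: centred vectors of Euclidean norm at most `B`. -/
def paramSet (d : ℕ) (B : ℝ) : Set (EuclideanSpace ℝ (Fin d)) :=
  {θ | ∑ j, θ j = 0 ∧ ‖θ‖ ≤ B}

/-- A randomized algorithm assigns to every dataset the law of its output. -/
abbrev RandomizedAlgorithm (S A : Type*) (n : ℕ) (Θ : Type*) [MeasurableSpace Θ] :=
  Dataset S A n → ProbabilityMeasure Θ

/-- Two datasets that differ exactly in the label of one sample. -/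
def LabelNeighbors {S A : Type*} {n : ℕ} (D D' : Dataset S A n) : Prop :=
  ∃ i, (D i).1 = (D' i).1 ∧ (D i).2 ≠ (D' i).2 ∧ ∀ j, j ≠ i → D j = D' j

/-- `(ε, δ)`-label differential privacy in the central model. -/
def CentralLabelDP {S A : Type*} {n : ℕ} {Θ : Type*} [MeasurableSpace Θ]
    (M : RandomizedAlgorithm S A n Θ) (ε δ : ℝ) : Prop :=
  ∀ D D' : Dataset S A n, LabelNeighbors D D' → ∀ E : Set Θ, MeasurableSet E →
    (M D : Measure Θ) E ≤ ENNReal.ofReal (Real.exp ε) * (M D' : Measure Θ) E + ENNReal.ofReal δ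

/-- The mean squared error `𝔼 ‖θ̂ - θ‖²` of the estimator `M` when the queries `q` are fixed, the
labels are drawn independently from the BTL model with parameter `θ`, and `θ̂` is then drawn from
the law that `M` assigns to the resulting dataset. It takes values in `[0, ∞]`. -/
noncomputable def estimationError {S A : Type*} {d n : ℕ}
    (φ : S → A → EuclideanSpace ℝ (Fin d)) (q : Fin n → Query S A)
    (M : RandomizedAlgorithm S A n (EuclideanSpace ℝ (Fin d)))
    (θ : EuclideanSpace ℝ (Fin d)) : ℝ≥0∞ :=
  ∑ y : Fin n → Bool, ENNReal.ofReal (∏ i, btlProb φ θ (q i) (y i)) *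
    ∫⁻ t, ENNReal.ofReal (‖t - θ‖ ^ 2)
      ∂(M (fun i => (q i, y i)) : Measure (EuclideanSpace ℝ (Fin d)))

/-! The proof applies Assouad's method to hypercubes in the centred hyperplane, whose dimension is
`m = d - 1`. The vertices are `θ₀ ± a v₁ ± ... ± a vₘ` with `v` orthonormal. An estimator yields a
test for each sign, and each wrong sign costs `a ^ 2` in squared error
(`ofReal_sum_testError_le_lintegral`). It therefore suffices that, averaged over vertices and
coordinates, the label laws at two adjacent vertices are hard to tell apart
(`exists_estimationError_ge`).

The statistical term uses the Hellinger affinity of the label laws (`half_exp_le_sum_testError`).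
Summed over coordinates, the squared changes of the logits are at most of order `a² n L²`, which
permits `a² ≍ d / (n L²)`.

The privacy term uses that label DP makes the acceptance probability of every test change by at most
`2 (ε + δ)` per label. By coupling, adjacent vertices are hard to separate when the label
probabilities change by a total of at most order `1 / (ε + δ)` (`one_sub_le_sum_testError`). This
permits `a ≍ 1 / (n (ε + δ))`, provided that a flip changes each label probability by `O(a)` on
average over the coordinates.

For features of norm at most `√d` this follows from the Lipschitz bound. For `B ≥ 1` and features of
any size, the centre is drawn from a Gaussian of scale `B / √m`: long features give widely spread
logits, most of them in the flat part of the sigmoid, and the norm of the feature cancels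
(`exists_center_sum_abs_sigmoid_sub_le`). In the remaining case the sample size condition makes the
statistical term dominate. -/

/-! ### Affinity of logistic label laws -/

/-- The probability of the label `l` under a logistic model with logit `u`. -/
noncomputable def logisticProb (u : ℝ) (l : Bool) : ℝ :=
  Real.sigmoid (if l then u else -u)

lemma logisticProb_nonneg (u : ℝ) (l : Bool) : 0 ≤ logisticProb u l := Real.sigmoid_nonneg _

lemma sum_logisticProb (u : ℝ) : ∑ l, logisticProb u l = 1 := by
  simp [logisticProb, Real.sigmoid_neg]

lemma abs_sigmoid_sub_sigmoid_le (u v : ℝ) : |Real.sigmoid u - Real.sigmoid v| ≤ |u - v| := by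
  have h := Convex.norm_image_sub_le_of_norm_deriv_le (f := Real.sigmoid) (C := 1) (s := Set.univ)
    (x := v) (y := u) (fun x _ => differentiableAt_sigmoid) (fun x _ => by
      rw [Real.deriv_sigmoid, Real.norm_eq_abs, abs_le]
      have h0 := Real.sigmoid_nonneg x
      have h1 := Real.sigmoid_le_one x
      constructor <;> nlinarith) convex_univ (Set.mem_univ _) (Set.mem_univ _)
  simpa using h

/-- Since `σ(2x) = exp x / (2 cosh x)`, the claim reduces to `cosh (s + t) cosh (s - t) = cosh² s
cosh² t - sinh² s sinh² t ≤ (cosh s cosh t)²`. -/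
lemma exp_div_le_sqrt_sigmoid_mul (s t : ℝ) :
    Real.exp s / (2 * (Real.cosh s * Real.cosh t)) ≤
      √(Real.sigmoid (2 * (s + t)) * Real.sigmoid (2 * (s - t))) := by
  have key (x : ℝ) : Real.sigmoid (2 * x) = Real.exp x / (2 * Real.cosh x) := by
    rw [Real.sigmoid_def, Real.cosh_eq, eq_div_iff (by positivity), inv_mul_eq_iff_eq_mul₀
      (by positivity), add_mul, ← Real.exp_add]
    ring_nf
  have hc := Real.cosh_pos s
  have hc' := Real.cosh_pos t
  refine Real.le_sqrt_of_sq_le ?_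
  rw [key, key, div_mul_div_comm, ← Real.exp_add, div_pow, ← Real.exp_nat_mul]
  have h1 := Real.cosh_pos (s + t)
  have h2 := Real.cosh_pos (s - t)
  have e : ((2 : ℕ) : ℝ) * s = s + t + (s - t) := by push_cast; ring
  rw [e]
  refine div_le_div_of_nonneg_left (Real.exp_pos _).le (by positivity) ?_
  rw [Real.cosh_add, Real.cosh_sub]
  nlinarith [sq_nonneg (Real.sinh s * Real.sinh t)]

/-- The Bhattacharyya coefficient of two logistic label distributions. -/
lemma exp_le_sum_sqrt_logisticProb (u v : ℝ) :
    Real.exp (-(u - v) ^ 2 / 32) ≤ ∑ l, √(logisticProb u l * logisticProb v l) := by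
  obtain ⟨s, t, rfl, rfl⟩ : ∃ s t : ℝ, u = 2 * (s + t) ∧ v = 2 * (s - t) :=
    ⟨(u + v) / 4, (u - v) / 4, by ring, by ring⟩
  have h1 := exp_div_le_sqrt_sigmoid_mul s t
  have h2 := exp_div_le_sqrt_sigmoid_mul (-s) (-t)
  have e1 : 2 * (-s + -t) = -(2 * (s + t)) := by ring
  have e2 : 2 * (-s - -t) = -(2 * (s - t)) := by ring
  rw [Real.cosh_neg, Real.cosh_neg, e1, e2] at h2
  simp only [logisticProb, Fintype.sum_bool, if_true, Bool.false_eq_true, if_false]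
  have hs := Real.cosh_pos s
  have ht := Real.cosh_pos t
  have h3 : Real.exp s / (2 * (Real.cosh s * Real.cosh t)) +
      Real.exp (-s) / (2 * (Real.cosh s * Real.cosh t)) = (Real.cosh t)⁻¹ := by
    rw [← add_div, ← mul_assoc, show 2 * Real.cosh s = Real.exp s + Real.exp (-s) by
      rw [Real.cosh_eq]; ring]
    have : 0 < Real.exp s + Real.exp (-s) := by positivity
    field_simp
  -- The two labels together contribute `1 / cosh t` with `t = (u - v) / 4`, and `cosh t ≤ exp (t² /
  -- 2)` produces the constant `32`.
  have h4 : Real.exp (-(2 * (s + t) - 2 * (s - t)) ^ 2 / 32) ≤ (Real.cosh t)⁻¹ := by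
    rw [show -(2 * (s + t) - 2 * (s - t)) ^ 2 / 32 = -(t ^ 2 / 2) by ring, Real.exp_neg]
    exact inv_anti₀ ht (Real.cosh_le_exp_half_sq t)
  linarith

/-- The law of independent labels with logits `u`. -/
noncomputable def labelProb {n : ℕ} (u : Fin n → ℝ) (y : Fin n → Bool) : ℝ :=
  ∏ i, logisticProb (u i) (y i)

lemma labelProb_nonneg {n : ℕ} (u : Fin n → ℝ) (y : Fin n → Bool) : 0 ≤ labelProb u y :=
  Finset.prod_nonneg fun _ _ => logisticProb_nonneg _ _

lemma sum_prod_bool {n : ℕ} (w : Fin n → Bool → ℝ) :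
    ∑ y : Fin n → Bool, ∏ i, w i (y i) = ∏ i, ∑ l, w i l := by
  rw [Finset.prod_univ_sum, Fintype.piFinset_univ]

lemma sum_labelProb {n : ℕ} (u : Fin n → ℝ) : ∑ y, labelProb u y = 1 := by
  simp only [labelProb, sum_prod_bool, sum_logisticProb, Finset.prod_const_one]

/-- The Bhattacharyya coefficient is multiplicative over independent labels. -/
lemma exp_le_sum_sqrt_labelProb {n : ℕ} (u v : Fin n → ℝ) :
    Real.exp (-(∑ i, (u i - v i) ^ 2) / 32) ≤ ∑ y, √(labelProb u y * labelProb v y) := by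
  have : ∀ y : Fin n → Bool, √(labelProb u y * labelProb v y) =
      ∏ i, √(logisticProb (u i) (y i) * logisticProb (v i) (y i)) := fun y => by
    rw [labelProb, labelProb, ← Finset.prod_mul_distrib, Real.sqrt_prod]
    exact fun i _ => mul_nonneg (logisticProb_nonneg _ _) (logisticProb_nonneg _ _)
  simp_rw [this]
  rw [sum_prod_bool fun i l => √(logisticProb (u i) l * logisticProb (v i) l),
    neg_div, Finset.sum_div, ← Finset.sum_neg_distrib, Real.exp_sum]
  refine Finset.prod_le_prod (fun _ _ => (Real.exp_pos _).le) fun i _ => ?_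
  rw [← neg_div]
  exact exp_le_sum_sqrt_logisticProb _ _

/-- Le Cam's bound of the overlap of two probability vectors by their Bhattacharyya coefficient. -/
lemma sq_sum_sqrt_le_two_mul_sum_min {ι : Type*} [Fintype ι] (p q : ι → ℝ) (hp : ∀ i, 0 ≤ p i)
    (hq : ∀ i, 0 ≤ q i) (hp1 : ∑ i, p i = 1) (hq1 : ∑ i, q i = 1) :
    (∑ i, √(p i * q i)) ^ 2 ≤ 2 * ∑ i, min (p i) (q i) := by
  have h0 : ∀ i, 0 ≤ min (p i) (q i) := fun i => le_min (hp i) (hq i)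
  -- Cauchy–Schwarz applied to `p q = min (p, q) · max (p, q)`; the maxima sum to at most `2`.
  have h := Finset.sum_mul_sq_le_sq_mul_sq Finset.univ (fun i => √(min (p i) (q i)))
    (fun i => √(max (p i) (q i)))
  have e1 : ∀ i, √(min (p i) (q i)) * √(max (p i) (q i)) = √(p i * q i) := fun i => by
    rw [← Real.sqrt_mul (h0 i), min_mul_max]
  have e2 : ∀ i, √(min (p i) (q i)) ^ 2 = min (p i) (q i) := fun i => Real.sq_sqrt (h0 i)
  have e3 : ∀ i, √(max (p i) (q i)) ^ 2 = max (p i) (q i) :=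
    fun i => Real.sq_sqrt ((hp i).trans (le_max_left _ _))
  simp_rw [e1, e2, e3] at h
  have h4 : ∑ i, max (p i) (q i) ≤ 2 := by
    calc ∑ i, max (p i) (q i) ≤ ∑ i, (p i + q i) := Finset.sum_le_sum fun i _ =>
          max_le (by linarith [hq i]) (by linarith [hp i])
      _ = 2 := by rw [Finset.sum_add_distrib, hp1, hq1]; norm_num
  have h5 : 0 ≤ ∑ i, min (p i) (q i) := Finset.sum_nonneg fun i _ => h0 i
  nlinarith

/-! ### Expectations of functions stable under the change of one label -/

/-- A function that changes by at most `K` when one label changes has close expectations under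
close product laws. -/
lemma abs_sum_prod_mul_sub_le {n : ℕ} {K : ℝ} (p q : Fin n → Bool → ℝ) (hp : ∀ i l, 0 ≤ p i l)
    (hq : ∀ i l, 0 ≤ q i l) (hp1 : ∀ i, ∑ l, p i l = 1) (hq1 : ∀ i, ∑ l, q i l = 1)
    (f : (Fin n → Bool) → ℝ) (hf : ∀ y i l, |f y - f (Function.update y i l)| ≤ K) :
    |∑ y, (∏ i, p i (y i)) * f y - ∑ y, (∏ i, q i (y i)) * f y| ≤
      K * ∑ i, |p i true - q i true| := by
  induction n with
  | zero => simp
  | succ n ih =>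
    have split : ∀ w : Fin (n + 1) → Bool → ℝ, ∑ y, (∏ i, w i (y i)) * f y =
        w 0 true * ∑ y : Fin n → Bool, (∏ i, w i.succ (y i)) * f (Fin.cons true y) +
        w 0 false * ∑ y : Fin n → Bool, (∏ i, w i.succ (y i)) * f (Fin.cons false y) := by
      intro w
      rw [← (Fin.consEquiv fun _ => Bool).sum_comp, Fintype.sum_prod_type]
      simp [Fin.consEquiv, Fin.prod_univ_succ, Finset.mul_sum, mul_assoc]
    have hK : ∀ l, |∑ y : Fin n → Bool, (∏ i, p i.succ (y i)) * f (Fin.cons l y) -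
        ∑ y : Fin n → Bool, (∏ i, q i.succ (y i)) * f (Fin.cons l y)| ≤
        K * ∑ i : Fin n, |p i.succ true - q i.succ true| := fun l =>
      ih _ _ (fun i => hp _) (fun i => hq _) (fun i => hp1 _) (fun i => hq1 _) _ fun y i l' => by
        rw [Fin.cons_update]; exact hf _ _ _
    have hD : |∑ y : Fin n → Bool, (∏ i, q i.succ (y i)) * f (Fin.cons true y) -
        ∑ y : Fin n → Bool, (∏ i, q i.succ (y i)) * f (Fin.cons false y)| ≤ K := by
      rw [← Finset.sum_sub_distrib]
      calc _ ≤ ∑ y : Fin n → Bool, |(∏ i, q i.succ (y i)) * f (Fin.cons true y) -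
              (∏ i, q i.succ (y i)) * f (Fin.cons false y)| := Finset.abs_sum_le_sum_abs _ _
        _ ≤ ∑ y : Fin n → Bool, (∏ i, q i.succ (y i)) * K := by
          refine Finset.sum_le_sum fun y _ => ?_
          have h0 : 0 ≤ ∏ i, q i.succ (y i) := Finset.prod_nonneg fun _ _ => hq _ _
          rw [← mul_sub, abs_mul, abs_of_nonneg h0]
          refine mul_le_mul_of_nonneg_left ?_ h0
          have := hf (Fin.cons true y) 0 false
          rwa [Fin.update_cons_zero] at this
        _ = K := by
          rw [← Finset.sum_mul, sum_prod_bool fun i => q i.succ]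
          simp only [hq1, Finset.prod_const_one, one_mul]
    rw [split p, split q, Fin.sum_univ_succ]
    have ht := hK true
    have hf' := hK false
    set P1 := ∑ y : Fin n → Bool, (∏ i, p i.succ (y i)) * f (Fin.cons true y)
    set P0 := ∑ y : Fin n → Bool, (∏ i, p i.succ (y i)) * f (Fin.cons false y)
    set Q1 := ∑ y : Fin n → Bool, (∏ i, q i.succ (y i)) * f (Fin.cons true y)
    set Q0 := ∑ y : Fin n → Bool, (∏ i, q i.succ (y i)) * f (Fin.cons false y)
    set S := ∑ i : Fin n, |p i.succ true - q i.succ true|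
    have a1 : p 0 false = 1 - p 0 true := by have := hp1 0; rw [Fintype.sum_bool] at this; linarith
    have a2 : q 0 false = 1 - q 0 true := by have := hq1 0; rw [Fintype.sum_bool] at this; linarith
    have b1 := hp 0 true
    have b2 := hp 0 false
    -- Hybrid argument: the later labels are exchanged first, conditionally on label `0`, and then
    -- the law of label `0` itself. The last term needs only the stability bound `|Q1 - Q0| ≤ K`.
    have e : p 0 true * P1 + p 0 false * P0 - (q 0 true * Q1 + q 0 false * Q0) =
        p 0 true * (P1 - Q1) + p 0 false * (P0 - Q0) + (p 0 true - q 0 true) * (Q1 - Q0) := by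
      rw [a1, a2]; ring
    rw [e]
    calc _ ≤ |p 0 true * (P1 - Q1)| + |p 0 false * (P0 - Q0)| +
            |(p 0 true - q 0 true) * (Q1 - Q0)| := abs_add_three _ _ _
      _ ≤ p 0 true * (K * S) + p 0 false * (K * S) + |p 0 true - q 0 true| * K := by
          rw [abs_mul, abs_mul, abs_mul, abs_of_nonneg b1, abs_of_nonneg b2]
          gcongr
      _ = _ := by rw [a1]; ring

lemma abs_sum_labelProb_mul_sub_le {n : ℕ} {K : ℝ} (u v : Fin n → ℝ)
    (f : (Fin n → Bool) → ℝ) (hf : ∀ y i l, |f y - f (Function.update y i l)| ≤ K) :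
    |∑ y, labelProb u y * f y - ∑ y, labelProb v y * f y| ≤
      K * ∑ i, |Real.sigmoid (u i) - Real.sigmoid (v i)| :=
  abs_sum_prod_mul_sub_le (fun i => logisticProb (u i)) (fun i => logisticProb (v i))
    (fun _ => logisticProb_nonneg _) (fun _ => logisticProb_nonneg _)
    (fun _ => sum_logisticProb _) (fun _ => sum_logisticProb _) f hf

/-! ### Assouad averaging and two-point testing bounds -/

/-- The hypercube vertex `τ` with its coordinate `j` flipped. -/
def flipAt {m : ℕ} (j : Fin m) (τ : Fin m → Bool) : Fin m → Bool :=
  Function.update τ j (!τ j)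

lemma flipAt_self {m : ℕ} (j : Fin m) (τ : Fin m → Bool) : flipAt j τ j = !τ j := by
  simp [flipAt]

lemma flipAt_involutive {m : ℕ} (j : Fin m) : Function.Involutive (flipAt j) := fun τ => by
  simp [flipAt]

/-- Assouad's averaging argument over the hypercube. -/
lemma exists_sum_ge_of_flipAt {m : ℕ} {R : ℝ} (h w : (Fin m → Bool) → Fin m → ℝ)
    (hw : ∀ τ j, w τ j ≤ h τ j + h (flipAt j τ) j) (hR : 2 ^ m * R ≤ ∑ τ, ∑ j, w τ j) :
    ∃ τ, R / 2 ≤ ∑ j, h τ j := by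
  have h1 : ∑ τ, ∑ j, w τ j ≤ 2 * ∑ τ, ∑ j, h τ j := by
    have e : ∑ τ, ∑ j, h (flipAt j τ) j = ∑ τ, ∑ j, h τ j := by
      rw [Finset.sum_comm, Finset.sum_comm (f := fun τ j => h τ j)]
      exact Finset.sum_congr rfl fun j _ =>
        (flipAt_involutive j).bijective.sum_comp fun τ => h τ j
    calc _ ≤ ∑ τ, ∑ j, (h τ j + h (flipAt j τ) j) :=
          Finset.sum_le_sum fun τ _ => Finset.sum_le_sum fun j _ => hw τ j
      _ = _ := by simp_rw [Finset.sum_add_distrib]; rw [e]; ring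
  by_contra! hc
  have h2 : ∑ τ, ∑ j, h τ j < ∑ _τ : Fin m → Bool, R / 2 :=
    Finset.sum_lt_sum_of_nonempty Finset.univ_nonempty fun τ _ => hc τ
  simp only [Finset.sum_const, Finset.card_univ, Fintype.card_fun, Fintype.card_bool,
    Fintype.card_fin, nsmul_eq_mul] at h2
  push_cast at h2
  linarith

/-- The error of the test that accepts `true` with probability `f` when the truth is `l`. -/
def testError (l : Bool) (f : ℝ) : ℝ := if l then 1 - f else f

lemma testError_not (l : Bool) (f : ℝ) : testError (!l) f = 1 - testError l f := by
  cases l <;> simp [testError]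

lemma testError_mem (l : Bool) {f : ℝ} (h0 : 0 ≤ f) (h1 : f ≤ 1) :
    0 ≤ testError l f ∧ testError l f ≤ 1 := by
  cases l <;> simp [testError, h0, h1]

lemma abs_testError_sub (l : Bool) (f g : ℝ) : |testError l f - testError l g| = |f - g| := by
  cases l
  · simp [testError]
  · simp [testError, abs_sub_comm]

/-- Two-point bound from the Hellinger affinity. -/
lemma half_exp_le_sum_testError {n : ℕ} (u v : Fin n → ℝ) (l : Bool) (f : (Fin n → Bool) → ℝ)
    (h0 : ∀ y, 0 ≤ f y) (h1 : ∀ y, f y ≤ 1) :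
    Real.exp (-(∑ i, (u i - v i) ^ 2) / 16) / 2 ≤
      ∑ y, labelProb u y * testError l (f y) + ∑ y, labelProb v y * testError (!l) (f y) := by
  have a := sq_sum_sqrt_le_two_mul_sum_min (labelProb u) (labelProb v) (labelProb_nonneg u)
    (labelProb_nonneg v) (sum_labelProb u) (sum_labelProb v)
  have b := pow_le_pow_left₀ (Real.exp_pos _).le (exp_le_sum_sqrt_labelProb u v) 2
  rw [← Real.exp_nat_mul] at b
  have e : ((2 : ℕ) : ℝ) * (-(∑ i, (u i - v i) ^ 2) / 32) = -(∑ i, (u i - v i) ^ 2) / 16 := by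
    push_cast; ring
  rw [e] at b
  have c : ∑ y, min (labelProb u y) (labelProb v y) ≤
      ∑ y, labelProb u y * testError l (f y) + ∑ y, labelProb v y * testError (!l) (f y) := by
    rw [← Finset.sum_add_distrib]
    refine Finset.sum_le_sum fun y _ => ?_
    rw [testError_not]
    obtain ⟨t0, t1⟩ := testError_mem l (h0 y) (h1 y)
    -- With `t` the test error, `p t + q (1 - t)` is at least the convex combination `min t + min (1
    -- - t)`.
    nlinarith [min_le_left (labelProb u y) (labelProb v y),
      min_le_right (labelProb u y) (labelProb v y)]
  linarith

/-- Two-point bound for tests that are stable under the change of one label. -/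
lemma one_sub_le_sum_testError {n : ℕ} {K : ℝ} (u v : Fin n → ℝ) (l : Bool)
    (f : (Fin n → Bool) → ℝ) (hf : ∀ y i l, |f y - f (Function.update y i l)| ≤ K) :
    1 - K * ∑ i, |Real.sigmoid (u i) - Real.sigmoid (v i)| ≤
      ∑ y, labelProb u y * testError l (f y) + ∑ y, labelProb v y * testError (!l) (f y) := by
  have h := abs_sum_labelProb_mul_sub_le u v (fun y => testError l (f y)) (K := K)
    (fun y i l' => by rw [abs_testError_sub]; exact hf y i l')
  simp_rw [testError_not, mul_sub, mul_one, Finset.sum_sub_distrib, sum_labelProb]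
  linarith [(abs_le.1 h).1]

/-! ### Gaussian smoothing of the logistic function -/

lemma abs_sigmoid_add_sub_eq {h : ℝ} (hh : 0 ≤ h) (u : ℝ) :
    |Real.sigmoid (u + h) - Real.sigmoid u| = Real.sigmoid (u + h) - Real.sigmoid u :=
  abs_of_nonneg (sub_nonneg.2 (Real.sigmoid_monotone (by linarith)))

/-- After translation the integral telescopes to the integral of `σ` over `[b, b + h]` minus the one
over `[a, a + h]`, and `0 ≤ σ ≤ 1`. -/
lemma intervalIntegral_sigmoid_add_sub_le {h : ℝ} (hh : 0 ≤ h) (a b : ℝ) :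
    ∫ u in a..b, (Real.sigmoid (u + h) - Real.sigmoid u) ≤ h := by
  have hi : ∀ x y, IntervalIntegrable Real.sigmoid volume x y :=
    fun x y => continuous_sigmoid.intervalIntegrable x y
  have hi' : IntervalIntegrable (fun u => Real.sigmoid (u + h)) volume a b :=
    (continuous_sigmoid.comp (continuous_add_const h)).intervalIntegrable _ _
  rw [intervalIntegral.integral_sub hi' (hi _ _),
    intervalIntegral.integral_comp_add_right,
    intervalIntegral.integral_interval_sub_interval_comm' (hi _ _) (hi _ _) (hi _ _)]
  have h1 : ∫ u in b..b + h, Real.sigmoid u ≤ ∫ _u in b..b + h, (1 : ℝ) :=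
    intervalIntegral.integral_mono (by linarith) (hi _ _) (by simp)
      fun u => Real.sigmoid_le_one u
  have h2 : 0 ≤ ∫ u in a..a + h, Real.sigmoid u :=
    intervalIntegral.integral_nonneg (by linarith) fun u _ => Real.sigmoid_nonneg u
  simp at h1
  linarith

lemma integrable_abs_sigmoid_add_sub {h : ℝ} (hh : 0 ≤ h) :
    Integrable (fun u => |Real.sigmoid (u + h) - Real.sigmoid u|) ∧
      ∫ u, |Real.sigmoid (u + h) - Real.sigmoid u| ≤ h := by
  have hc : Continuous fun u => |Real.sigmoid (u + h) - Real.sigmoid u| := by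
    have := continuous_sigmoid
    fun_prop
  have hb : ∀ r : ℕ, ∫ u in -(r : ℝ)..r, |Real.sigmoid (u + h) - Real.sigmoid u| ≤ h := fun r => by
    simp_rw [abs_sigmoid_add_sub_eq hh]
    exact intervalIntegral_sigmoid_add_sub_le hh _ _
  have t1 : Filter.Tendsto (fun r : ℕ => -(r : ℝ)) Filter.atTop Filter.atBot :=
    Filter.tendsto_neg_atTop_atBot.comp tendsto_natCast_atTop_atTop
  have t2 : Filter.Tendsto (fun r : ℕ => (r : ℝ)) Filter.atTop Filter.atTop :=
    tendsto_natCast_atTop_atTop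
  have hint : Integrable (fun u => |Real.sigmoid (u + h) - Real.sigmoid u|) := by
    refine integrable_of_intervalIntegral_norm_bounded (a := fun r : ℕ => -(r : ℝ)) h
      (fun r => (hc.integrableOn_Icc (a := -(r : ℝ)) (b := r)).mono_set Set.Ioc_subset_Icc_self)
      t1 t2 (Filter.Eventually.of_forall fun r => ?_)
    simp_rw [Real.norm_eq_abs, abs_abs]
    exact hb r
  exact ⟨hint, le_of_tendsto' (intervalIntegral_tendsto_integral hint t1 t2) hb⟩

/-- This `L¹` bound over the whole line is what later removes the dependence on the size of the
features: multiplied by a bound on a density, it controls the mean sensitivity of the sigmoid. -/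
lemma integral_abs_sigmoid_sub_le (c c' : ℝ) :
    Integrable (fun u => |Real.sigmoid (u + c) - Real.sigmoid (u + c')|) ∧
      ∫ u, |Real.sigmoid (u + c) - Real.sigmoid (u + c')| ≤ |c - c'| := by
  wlog h : c' ≤ c generalizing c c'
  · simp_rw [abs_sub_comm (Real.sigmoid (_ + c)), abs_sub_comm c]
    exact this c' c (not_le.1 h).le
  have e : (fun u => |Real.sigmoid (u + c) - Real.sigmoid (u + c')|) =
      fun u => (fun u => |Real.sigmoid (u + (c - c')) - Real.sigmoid u|) (u + c') := by
    ext u; simp only; congr 3; ring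
  obtain ⟨h1, h2⟩ := integrable_abs_sigmoid_add_sub (sub_nonneg.2 h)
  rw [e, abs_of_nonneg (sub_nonneg.2 h)]
  refine ⟨h1.comp_add_right c', ?_⟩
  rwa [integral_add_right_eq_self (fun u => |Real.sigmoid (u + (c - c')) - Real.sigmoid u|)]

/-- Smoothing by a Gaussian with standard deviation `s` makes the logistic function
`O(1 / s)`-Lipschitz. -/
lemma integral_gaussianReal_abs_sigmoid_sub_le {s : ℝ} (hs : 0 < s) (μ c c' : ℝ) :
    ∫ u, |Real.sigmoid (u + c) - Real.sigmoid (u + c')|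
      ∂(ProbabilityTheory.gaussianReal μ (s ^ 2).toNNReal) ≤ |c - c'| / (2 * s) := by
  have hv : (s ^ 2).toNNReal ≠ 0 := by
    simpa using hs.ne'
  rw [ProbabilityTheory.integral_gaussianReal_eq_integral_smul hv]
  obtain ⟨h1, h2⟩ := integral_abs_sigmoid_sub_le c c'
  -- The peak of the density is `1 / √(2π s²)`, and `2π ≥ 4`.
  have hpdf : ∀ u, ProbabilityTheory.gaussianPDFReal μ (s ^ 2).toNNReal u ≤ 1 / (2 * s) := by
    intro u
    rw [ProbabilityTheory.gaussianPDFReal, Real.coe_toNNReal _ (sq_nonneg s)]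
    have e1 : Real.exp (-(u - μ) ^ 2 / (2 * s ^ 2)) ≤ 1 := by
      rw [Real.exp_le_one_iff, neg_div]
      exact neg_nonpos.2 (by positivity)
    have e2 : (√(2 * Real.pi * s ^ 2))⁻¹ ≤ 1 / (2 * s) := by
      rw [one_div]
      refine inv_anti₀ (by positivity) (Real.le_sqrt_of_sq_le ?_)
      nlinarith [Real.pi_gt_three, sq_nonneg s]
    calc _ ≤ (√(2 * Real.pi * s ^ 2))⁻¹ * 1 := by gcongr
      _ ≤ _ := by rwa [mul_one]
  calc _ ≤ ∫ u, 1 / (2 * s) * |Real.sigmoid (u + c) - Real.sigmoid (u + c')| := by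
        refine integral_mono_of_nonneg (Filter.Eventually.of_forall fun u => ?_)
          (h1.const_mul _) (Filter.Eventually.of_forall fun u => ?_)
        · exact mul_nonneg (ProbabilityTheory.gaussianPDFReal_nonneg _ _ _) (abs_nonneg _)
        · exact mul_le_mul_of_nonneg_right (hpdf u) (abs_nonneg _)
    _ = 1 / (2 * s) * ∫ u, |Real.sigmoid (u + c) - Real.sigmoid (u + c')| :=
        integral_const_mul _ _
    _ ≤ 1 / (2 * s) * |c - c'| := by gcongr
    _ = _ := by ring

section StdGaussian

variable {F : Type*} [NormedAddCommGroup F] [InnerProductSpace ℝ F] [FiniteDimensional ℝ F]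
  [MeasurableSpace F] [BorelSpace F]

lemma stdGaussian_map_inner (w : F) :
    (ProbabilityTheory.stdGaussian F).map (fun g => inner ℝ w g) =
      ProbabilityTheory.gaussianReal 0 (‖w‖ ^ 2).toNNReal := by
  have h := ProbabilityTheory.IsGaussian.map_eq_gaussianReal
    (μ := ProbabilityTheory.stdGaussian F) (innerSL ℝ w)
  rw [ProbabilityTheory.variance_dual_stdGaussian,
    ProbabilityTheory.integral_strongDual_stdGaussian, innerSL_apply_norm] at h
  exact h

/-- The logit `⟪w, r g⟫` is a centred Gaussian of standard deviation `r ‖w‖`, so the one-dimensional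
smoothing bound applies. -/
lemma integral_stdGaussian_abs_sigmoid_sub_le {r : ℝ} (hr : 0 < r) {w : F} (hw : w ≠ 0)
    (c c' : ℝ) :
    ∫ g, |Real.sigmoid (inner ℝ w (r • g) + c) - Real.sigmoid (inner ℝ w (r • g) + c')|
      ∂(ProbabilityTheory.stdGaussian F) ≤ |c - c'| / (2 * (r * ‖w‖)) := by
  have hm : AEMeasurable (fun g : F => inner ℝ (r • w) g) (ProbabilityTheory.stdGaussian F) :=
    Measurable.aemeasurable (by fun_prop)
  have hc : Continuous fun u => |Real.sigmoid (u + c) - Real.sigmoid (u + c')| := by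
    have := continuous_sigmoid
    fun_prop
  have h := integral_map hm (f := fun u => |Real.sigmoid (u + c) - Real.sigmoid (u + c')|)
    hc.aestronglyMeasurable
  simp_rw [real_inner_smul_right, ← real_inner_smul_left]
  rw [← h, stdGaussian_map_inner, norm_smul, Real.norm_eq_abs, abs_of_pos hr]
  exact integral_gaussianReal_abs_sigmoid_sub_le (mul_pos hr (norm_pos_iff.2 hw)) _ _ _

lemma integrable_norm_sq_stdGaussian :
    Integrable (fun g : F => ‖g‖ ^ 2) (ProbabilityTheory.stdGaussian F) :=
  (ProbabilityTheory.IsGaussian.memLp_two_id (μ := ProbabilityTheory.stdGaussian F)).integrable_norm_pow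
    two_ne_zero

lemma integral_norm_sq_stdGaussian :
    ∫ g : F, ‖g‖ ^ 2 ∂(ProbabilityTheory.stdGaussian F) = Module.finrank ℝ F := by
  set b := stdOrthonormalBasis ℝ F
  have hL (L : StrongDual ℝ F) : ∫ g, L g ^ 2 ∂(ProbabilityTheory.stdGaussian F) = ‖L‖ ^ 2 := by
    rw [← ProbabilityTheory.variance_dual_stdGaussian L,
      ProbabilityTheory.variance_of_integral_eq_zero L.continuous.aemeasurable
        (ProbabilityTheory.integral_strongDual_stdGaussian L)]
  have hi (i) : Integrable (fun g : F => inner ℝ (b i) g ^ 2)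
      (ProbabilityTheory.stdGaussian F) := by
    refine integrable_norm_sq_stdGaussian.mono (Measurable.aestronglyMeasurable (by fun_prop))
      (Filter.Eventually.of_forall fun g => ?_)
    have := abs_real_inner_le_norm (b i) g
    rw [b.orthonormal.1 i, one_mul] at this
    simp only [norm_pow, Real.norm_eq_abs, abs_norm]
    gcongr
  have e : ∀ i, ∫ g : F, inner ℝ (b i) g ^ 2 ∂(ProbabilityTheory.stdGaussian F) = 1 := fun i => by
    have := hL (innerSL ℝ (b i))
    rwa [innerSL_apply_norm, b.orthonormal.1 i, one_pow] at this
  simp_rw [← b.sum_sq_inner_right]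
  rw [integral_finsetSum _ fun i _ => hi i]
  simp [e]

end StdGaussian

lemma sum_abs_le_sqrt_mul_norm {m : ℕ} (w : EuclideanSpace ℝ (Fin m)) :
    ∑ j, |w j| ≤ √m * ‖w‖ := by
  have h := Finset.sum_mul_sq_le_sq_mul_sq Finset.univ (fun _ : Fin m => (1 : ℝ)) (fun j => |w j|)
  rw [EuclideanSpace.norm_eq, ← Real.sqrt_mul (by positivity)]
  refine Real.le_sqrt_of_sq_le ?_
  simpa using h

/-- A Gaussian centre makes the logistic model insensitive on average to flips of the hypercube,
however large the features are. -/
lemma exists_center_sum_abs_sigmoid_sub_le {m n : ℕ} (hm : 0 < m) (hn : 0 < n) {a B : ℝ}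
    (ha : 0 < a) (hB : 1 ≤ B) (w : Fin n → EuclideanSpace ℝ (Fin m))
    (c : (Fin m → Bool) → Fin n → ℝ)
    (hc : ∀ τ j i, |c τ i - c (flipAt j τ) i| ≤ 2 * a * |w i j|) :
    ∃ g : EuclideanSpace ℝ (Fin m), ‖g‖ ≤ B / 2 ∧
      ∑ τ, ∑ j, ∑ i, |Real.sigmoid (inner ℝ (w i) g + c τ i) -
        Real.sigmoid (inner ℝ (w i) g + c (flipAt j τ) i)| ≤ 2 ^ m * (8 * a * m * n) := by
  have hm' : (0 : ℝ) < m := by exact_mod_cast hm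
  have hn' : (0 : ℝ) < n := by exact_mod_cast hn
  set γ := ProbabilityTheory.stdGaussian (EuclideanSpace ℝ (Fin m))
  -- With this scale `𝔼 ‖r g‖² = B² / 16`, which leaves room for the bound `B / 2` on the centre.
  set r : ℝ := B / (4 * √m)
  have hr : 0 < r := by positivity
  let G : EuclideanSpace ℝ (Fin m) → (Fin m → Bool) → Fin m → Fin n → ℝ := fun g τ j i =>
    |Real.sigmoid (inner ℝ (w i) g + c τ i) - Real.sigmoid (inner ℝ (w i) g + c (flipAt j τ) i)|
  have hG1 : ∀ g τ j i, |G g τ j i| ≤ 1 := fun g τ j i => by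
    rw [abs_abs, abs_le]
    constructor <;> linarith [Real.sigmoid_nonneg (inner ℝ (w i) g + c τ i),
      Real.sigmoid_nonneg (inner ℝ (w i) g + c (flipAt j τ) i),
      Real.sigmoid_le_one (inner ℝ (w i) g + c τ i),
      Real.sigmoid_le_one (inner ℝ (w i) g + c (flipAt j τ) i)]
  have hGi : ∀ τ j i, Integrable (fun g => G (r • g) τ j i) γ := fun τ j i => by
    refine Integrable.of_bound (C := 1) ?_ (Filter.Eventually.of_forall fun g => hG1 _ _ _ _)
    have := continuous_sigmoid
    exact Continuous.aestronglyMeasurable (by fun_prop)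
  have hGle : ∀ τ j i, ∫ g, G (r • g) τ j i ∂γ ≤ a * |w i j| / (r * ‖w i‖) := fun τ j i => by
    -- When `w i = 0` the right side is `0` by the convention for division by zero, and `hc` makes
    -- both logits equal.
    rcases eq_or_ne (w i) 0 with h0 | h0
    · have : c τ i = c (flipAt j τ) i := by
        have := hc τ j i
        rw [h0] at this
        simpa [sub_eq_zero] using this
      simp [G, this, h0]
    · have hw : 0 < ‖w i‖ := norm_pos_iff.2 h0
      refine (integral_stdGaussian_abs_sigmoid_sub_le hr h0 _ _).trans ?_
      rw [div_le_div_iff₀ (by positivity) (by positivity)]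
      have := mul_le_mul_of_nonneg_right (hc τ j i) (mul_pos hr hw).le
      linarith
  have hsum : ∀ τ i, ∑ j, ∫ g, G (r • g) τ j i ∂γ ≤ 4 * a * m := fun τ i => by
    refine (Finset.sum_le_sum fun j _ => hGle τ j i).trans ?_
    rw [← Finset.sum_div, ← Finset.mul_sum]
    have h1 := sum_abs_le_sqrt_mul_norm (w i)
    refine div_le_of_le_mul₀ (by positivity) (by positivity) ?_
    have h2 : m * r * 4 = √m * B := by
      have : (m : ℝ) = √m * √m := (Real.mul_self_sqrt hm'.le).symm
      simp only [r]
      field_simp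
      rw [Real.sq_sqrt hm'.le]
    -- The factor `‖w i‖` from Cauchy–Schwarz cancels the one in the denominator; `B ≥ 1` is used
    -- here to drop `B`.
    calc a * ∑ j, |w i j| ≤ a * (√m * ‖w i‖) := by gcongr
      _ ≤ a * (√m * B * ‖w i‖) := by
          gcongr
          exact le_mul_of_one_le_right (Real.sqrt_nonneg _) hB
      _ = _ := by rw [← h2]; ring
  have htot : ∫ g, ∑ τ, ∑ j, ∑ i, G (r • g) τ j i ∂γ ≤ 2 ^ m * (4 * a * m * n) := by
    rw [integral_finsetSum _ fun τ _ => integrable_finsetSum _ fun j _ =>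
      integrable_finsetSum _ fun i _ => hGi τ j i]
    have : ∀ τ, ∫ g, ∑ j, ∑ i, G (r • g) τ j i ∂γ ≤ 4 * a * m * n := fun τ => by
      rw [integral_finsetSum _ fun j _ => integrable_finsetSum _ fun i _ => hGi τ j i]
      simp_rw [fun j => integral_finsetSum Finset.univ fun i (_ : i ∈ Finset.univ) => hGi τ j i]
      rw [Finset.sum_comm]
      refine (Finset.sum_le_sum fun i _ => hsum τ i).trans ?_
      simp [mul_comm]
    refine (Finset.sum_le_sum fun τ _ => this τ).trans ?_
    simp
  set A : ℝ := 2 ^ m * (4 * a * m * n)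
  have hA : 0 < A := by positivity
  have hint1 : Integrable (fun g => ∑ τ, ∑ j, ∑ i, G (r • g) τ j i) γ :=
    integrable_finsetSum _ fun τ _ => integrable_finsetSum _ fun j _ =>
      integrable_finsetSum _ fun i _ => hGi τ j i
  have hint2 : Integrable (fun g : EuclideanSpace ℝ (Fin m) => A / m * ‖g‖ ^ 2) γ :=
    integrable_norm_sq_stdGaussian.const_mul _
  -- Both summands have mean at most `A`, so a point where their sum is at most `2 * A` controls the
  -- sensitivity and the norm of the centre at once.
  obtain ⟨g, hg⟩ := exists_le_integral (hint1.add hint2)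
  have hle : ∫ g, ((∑ τ, ∑ j, ∑ i, G (r • g) τ j i) + A / m * ‖g‖ ^ 2) ∂γ ≤ 2 * A := by
    rw [integral_add hint1 hint2, integral_const_mul, integral_norm_sq_stdGaussian,
      finrank_euclideanSpace_fin, div_mul_cancel₀ _ hm'.ne']
    linarith
  have hg' := hg.trans hle
  simp only [Pi.add_apply] at hg'
  have hG0 : 0 ≤ ∑ τ, ∑ j, ∑ i, G (r • g) τ j i :=
    Finset.sum_nonneg fun _ _ => Finset.sum_nonneg fun _ _ => Finset.sum_nonneg fun _ _ =>
      abs_nonneg _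
  have hA0 : 0 ≤ A / m * ‖g‖ ^ 2 := by positivity
  refine ⟨r • g, ?_, ?_⟩
  · have h1 : ‖g‖ ^ 2 ≤ 2 * m := by
      have : A / m * ‖g‖ ^ 2 ≤ A / m * (2 * m) := by
        rw [show A / m * (2 * m) = 2 * A by field_simp]; linarith
      exact le_of_mul_le_mul_left this (by positivity)
    have h2 : ‖g‖ ≤ 2 * √m := by
      refine le_of_sq_le_sq ?_ (by positivity)
      rw [mul_pow, Real.sq_sqrt hm'.le]
      linarith
    rw [norm_smul, Real.norm_eq_abs, abs_of_pos hr]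
    calc r * ‖g‖ ≤ r * (2 * √m) := by gcongr
      _ = B / 2 := by simp only [r]; field_simp; norm_num
  · calc _ = ∑ τ, ∑ j, ∑ i, G (r • g) τ j i := rfl
      _ ≤ 2 * A := by linarith
      _ = _ := by simp only [A]; ring

/-! ### The BTL model and hypercubes of parameters -/

lemma btlProb_eq_logisticProb {S A : Type*} {d : ℕ} (φ : S → A → EuclideanSpace ℝ (Fin d))
    (θ : EuclideanSpace ℝ (Fin d)) (q : Query S A) (l : Bool) :
    btlProb φ θ q l = logisticProb (inner ℝ (diffFeature φ q) θ) l := by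
  have h : inner ℝ (diffFeature φ q) θ =
      reward φ θ q.state (q.action true) - reward φ θ q.state (q.action false) := by
    rw [diffFeature, inner_sub_left]; rfl
  rw [btlProb, logisticProb, h, Real.sigmoid_def]
  cases l
  · simp only [Bool.false_eq_true, if_false, neg_neg, Real.exp_sub]
    have := Real.exp_pos (reward φ θ q.state (q.action true))
    have := Real.exp_pos (reward φ θ q.state (q.action false))
    field_simp
  · simp only [if_true, neg_sub, Real.exp_sub]
    have := Real.exp_pos (reward φ θ q.state (q.action true))
    have := Real.exp_pos (reward φ θ q.state (q.action false))
    field_simp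
    ring

lemma prod_btlProb_eq_labelProb {S A : Type*} {d n : ℕ} (φ : S → A → EuclideanSpace ℝ (Fin d))
    (θ : EuclideanSpace ℝ (Fin d)) (q : Fin n → Query S A) (y : Fin n → Bool) :
    ∏ i, btlProb φ θ (q i) (y i) =
      labelProb (fun i => inner ℝ (diffFeature φ (q i)) θ) y := by
  simp only [btlProb_eq_logisticProb, labelProb]

lemma norm_diffFeature_le {S A : Type*} {d : ℕ} {φ : S → A → EuclideanSpace ℝ (Fin d)} {L : ℝ}
    (hφ : ∀ s a, ‖φ s a‖ ≤ L) (q : Query S A) : ‖diffFeature φ q‖ ≤ 2 * L := by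
  refine (norm_sub_le _ _).trans ?_
  linarith [hφ q.state (q.action true), hφ q.state (q.action false)]

/-- The vertex `τ` of the hypercube with centre `θ₀`, half-width `a` and axes `v`. -/
noncomputable def cubePoint {E : Type*} [AddCommGroup E] [Module ℝ E] {m : ℕ} (θ₀ : E) (a : ℝ)
    (v : Fin m → E) (τ : Fin m → Bool) : E :=
  θ₀ + a • ∑ j, (if τ j then (1 : ℝ) else -1) • v j

section Cube

variable {E : Type*} [NormedAddCommGroup E] [InnerProductSpace ℝ E] {m : ℕ} {v : Fin m → E}

lemma inner_cubePoint (x θ₀ : E) (a : ℝ) (v : Fin m → E) (τ : Fin m → Bool) :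
    inner ℝ x (cubePoint θ₀ a v τ) =
      inner ℝ x θ₀ + a * ∑ j, (if τ j then (1 : ℝ) else -1) * inner ℝ x (v j) := by
  simp only [cubePoint, inner_add_right, real_inner_smul_right, inner_sum]

lemma sum_sign_sub_flipAt (s : Fin m → ℝ) (τ : Fin m → Bool) (j : Fin m) :
    ∑ k, (if τ k then (1 : ℝ) else -1) * s k - ∑ k, (if flipAt j τ k then (1 : ℝ) else -1) * s k =
      2 * (if τ j then (1 : ℝ) else -1) * s j := by
  rw [← Finset.sum_sub_distrib, Finset.sum_eq_single j]
  · rw [flipAt_self]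
    cases τ j <;> simp <;> ring
  · intro k _ hk
    simp [flipAt, Function.update_of_ne hk]
  · simp

lemma abs_sum_sign_sub_flipAt (s : Fin m → ℝ) (τ : Fin m → Bool) (j : Fin m) :
    |∑ k, (if τ k then (1 : ℝ) else -1) * s k - ∑ k, (if flipAt j τ k then (1 : ℝ) else -1) * s k| =
      2 * |s j| := by
  rw [sum_sign_sub_flipAt, abs_mul, abs_mul]
  cases τ j <;> simp

lemma abs_inner_cubePoint_sub_flipAt (x θ₀ : E) {a : ℝ} (ha : 0 ≤ a) (v : Fin m → E)
    (τ : Fin m → Bool) (j : Fin m) :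
    |inner ℝ x (cubePoint θ₀ a v τ) - inner ℝ x (cubePoint θ₀ a v (flipAt j τ))| =
      2 * a * |inner ℝ x (v j)| := by
  rw [inner_cubePoint, inner_cubePoint, add_sub_add_left_eq_sub, ← mul_sub, abs_mul,
    abs_of_nonneg ha, abs_sum_sign_sub_flipAt]
  ring

lemma Orthonormal.norm_sum_smul (hv : Orthonormal ℝ v) (c : Fin m → ℝ) :
    ‖∑ j, c j • v j‖ = √(∑ j, c j ^ 2) := by
  rw [norm_eq_sqrt_real_inner, hv.inner_sum]
  simp [sq]

lemma norm_cubePoint_le (hv : Orthonormal ℝ v) (θ₀ : E) {a : ℝ} (ha : 0 ≤ a)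
    (τ : Fin m → Bool) : ‖cubePoint θ₀ a v τ‖ ≤ ‖θ₀‖ + a * √m := by
  refine (norm_add_le _ _).trans ?_
  rw [norm_smul, hv.norm_sum_smul, Real.norm_eq_abs, abs_of_nonneg ha]
  simp

lemma Orthonormal.sum_sq_inner_le (hv : Orthonormal ℝ v) (x : E) :
    ∑ j, inner ℝ x (v j) ^ 2 ≤ ‖x‖ ^ 2 := by
  have h := hv.sum_inner_products_le x (s := Finset.univ)
  simpa [real_inner_comm] using h

/-- The test for the sign of the `j`-th coordinate of a point of the hypercube. -/
lemma sq_le_sq_inner_sub_cubePoint (hv : Orthonormal ℝ v) (θ₀ t : E) {a : ℝ} (ha : 0 ≤ a)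
    (τ : Fin m → Bool) (j : Fin m)
    (ht : if τ j then inner ℝ (v j) t < inner ℝ (v j) θ₀ else inner ℝ (v j) θ₀ ≤ inner ℝ (v j) t) :
    a ^ 2 ≤ inner ℝ (t - cubePoint θ₀ a v τ) (v j) ^ 2 := by
  have h : inner ℝ (v j) (cubePoint θ₀ a v τ) =
      inner ℝ (v j) θ₀ + a * (if τ j then (1 : ℝ) else -1) := by
    rw [inner_cubePoint]
    simp [orthonormal_iff_ite.1 hv]
  rw [real_inner_comm, inner_sub_right, h]
  cases hτ : τ j
  · simp only [hτ, Bool.false_eq_true, if_false] at ht ⊢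
    nlinarith
  · simp only [hτ, if_true] at ht ⊢
    nlinarith

end Cube

/-! ### From estimation to coordinatewise tests -/

/-- The probability that a random point lies in the half-space `{t | ⟪v, t⟫ ≥ ⟪v, θ₀⟫}`. -/
noncomputable def halfSpaceProb {d : ℕ} (μ : Measure (EuclideanSpace ℝ (Fin d)))
    (v θ₀ : EuclideanSpace ℝ (Fin d)) : ℝ :=
  μ.real {t | inner ℝ v θ₀ ≤ inner ℝ v t}

lemma measurableSet_halfSpace {d : ℕ} (v θ₀ : EuclideanSpace ℝ (Fin d)) :
    MeasurableSet {t : EuclideanSpace ℝ (Fin d) | inner ℝ v θ₀ ≤ inner ℝ v t} :=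
  measurableSet_le (by fun_prop) (by fun_prop)

/-- A squared error dominates the errors of the coordinatewise tests. -/
lemma ofReal_sum_testError_le_lintegral {d m : ℕ} (μ : Measure (EuclideanSpace ℝ (Fin d)))
    [IsProbabilityMeasure μ] {v : Fin m → EuclideanSpace ℝ (Fin d)} (hv : Orthonormal ℝ v)
    (θ₀ : EuclideanSpace ℝ (Fin d)) {a : ℝ} (ha : 0 ≤ a) (τ : Fin m → Bool) :
    ENNReal.ofReal (a ^ 2 * ∑ j, testError (τ j) (halfSpaceProb μ (v j) θ₀)) ≤
      ∫⁻ t, ENNReal.ofReal (‖t - cubePoint θ₀ a v τ‖ ^ 2) ∂μ := by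
  -- `W j` is the event that the `j`-th test decides for the wrong sign.
  let W : Fin m → Set (EuclideanSpace ℝ (Fin d)) := fun j =>
    if τ j then {t | inner ℝ (v j) θ₀ ≤ inner ℝ (v j) t}ᶜ
    else {t | inner ℝ (v j) θ₀ ≤ inner ℝ (v j) t}
  have hW : ∀ j, MeasurableSet (W j) := fun j => by
    simp only [W]
    split_ifs
    · exact (measurableSet_halfSpace _ _).compl
    · exact measurableSet_halfSpace _ _
  have hμW : ∀ j, testError (τ j) (halfSpaceProb μ (v j) θ₀) = μ.real (W j) := fun j => by
    cases h : τ j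
    · simp [testError, halfSpaceProb, W, h]
    · simp only [testError, halfSpaceProb, W, h, if_true]
      rw [probReal_compl_eq_one_sub (measurableSet_halfSpace _ _)]
  have e : ENNReal.ofReal (a ^ 2 * ∑ j, testError (τ j) (halfSpaceProb μ (v j) θ₀)) =
      ∫⁻ t, ∑ j, (W j).indicator (fun _ => ENNReal.ofReal (a ^ 2)) t ∂μ := by
    rw [lintegral_finsetSum _ fun j _ => measurable_const.indicator (hW j),
      Finset.mul_sum, ENNReal.ofReal_sum_of_nonneg fun j _ => by rw [hμW]; positivity]
    refine Finset.sum_congr rfl fun j _ => ?_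
    rw [lintegral_indicator_const (hW j), hμW, ENNReal.ofReal_mul (sq_nonneg a),
      ofReal_measureReal]
  rw [e]
  refine lintegral_mono fun t => ?_
  have h1 : ∀ j, (W j).indicator (fun _ => ENNReal.ofReal (a ^ 2)) t ≤
      ENNReal.ofReal (inner ℝ (t - cubePoint θ₀ a v τ) (v j) ^ 2) := fun j => by
    by_cases ht : t ∈ W j
    · rw [Set.indicator_of_mem ht]
      refine ENNReal.ofReal_le_ofReal (sq_le_sq_inner_sub_cubePoint hv θ₀ t ha τ j ?_)
      cases h : τ j <;> simpa [W, h] using ht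
    · simp [ht]
  calc _ ≤ ∑ j, ENNReal.ofReal (inner ℝ (t - cubePoint θ₀ a v τ) (v j) ^ 2) :=
        Finset.sum_le_sum fun j _ => h1 j
    _ = ENNReal.ofReal (∑ j, inner ℝ (t - cubePoint θ₀ a v τ) (v j) ^ 2) :=
        (ENNReal.ofReal_sum_of_nonneg fun j _ => sq_nonneg _).symm
    _ ≤ _ := ENNReal.ofReal_le_ofReal (hv.sum_sq_inner_le _)

section Estimation

variable {S A : Type*} {d n m : ℕ} {φ : S → A → EuclideanSpace ℝ (Fin d)}
  {v : Fin m → EuclideanSpace ℝ (Fin d)}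

/-- The acceptance probability of the test of the sign of `⟪v, θ - θ₀⟫` as a function of the
labels. -/
noncomputable def testProb (q : Fin n → Query S A)
    (M : RandomizedAlgorithm S A n (EuclideanSpace ℝ (Fin d)))
    (v θ₀ : EuclideanSpace ℝ (Fin d)) (y : Fin n → Bool) : ℝ :=
  halfSpaceProb (M fun i => (q i, y i)) v θ₀

lemma testProb_nonneg (q : Fin n → Query S A)
    (M : RandomizedAlgorithm S A n (EuclideanSpace ℝ (Fin d)))
    (v θ₀ : EuclideanSpace ℝ (Fin d)) (y : Fin n → Bool) : 0 ≤ testProb q M v θ₀ y :=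
  measureReal_nonneg

lemma testProb_le_one (q : Fin n → Query S A)
    (M : RandomizedAlgorithm S A n (EuclideanSpace ℝ (Fin d)))
    (v θ₀ : EuclideanSpace ℝ (Fin d)) (y : Fin n → Bool) : testProb q M v θ₀ y ≤ 1 :=
  measureReal_le_one

lemma ofReal_sum_testError_le_estimationError (hv : Orthonormal ℝ v) (q : Fin n → Query S A)
    (M : RandomizedAlgorithm S A n (EuclideanSpace ℝ (Fin d))) (θ₀ : EuclideanSpace ℝ (Fin d))
    {a : ℝ} (ha : 0 ≤ a) (τ : Fin m → Bool) :
    ENNReal.ofReal (a ^ 2 * ∑ j, ∑ y,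
      labelProb (fun i => inner ℝ (diffFeature φ (q i)) (cubePoint θ₀ a v τ)) y *
        testError (τ j) (testProb q M (v j) θ₀ y)) ≤
      estimationError φ q M (cubePoint θ₀ a v τ) := by
  have h0 : ∀ y, 0 ≤ ∑ j, testError (τ j) (testProb q M (v j) θ₀ y) := fun y =>
    Finset.sum_nonneg fun j _ =>
      (testError_mem _ (testProb_nonneg q M (v j) θ₀ y) (testProb_le_one q M (v j) θ₀ y)).1
  rw [estimationError, Finset.sum_comm]
  simp_rw [← Finset.mul_sum]
  rw [Finset.mul_sum, ENNReal.ofReal_sum_of_nonneg fun y _ =>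
    mul_nonneg (sq_nonneg a) (mul_nonneg (labelProb_nonneg _ _) (h0 y))]
  refine Finset.sum_le_sum fun y _ => ?_
  rw [prod_btlProb_eq_labelProb, mul_left_comm, ENNReal.ofReal_mul (labelProb_nonneg _ _)]
  gcongr
  exact ofReal_sum_testError_le_lintegral _ hv θ₀ ha τ

/-- Assouad's lemma for the estimation error over a hypercube of parameters. -/
lemma exists_estimationError_ge (hv : Orthonormal ℝ v) (q : Fin n → Query S A)
    (M : RandomizedAlgorithm S A n (EuclideanSpace ℝ (Fin d))) (θ₀ : EuclideanSpace ℝ (Fin d))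
    {a R : ℝ} (ha : 0 ≤ a) (w : (Fin m → Bool) → Fin m → ℝ)
    (hw : ∀ τ j, w τ j ≤
      ∑ y, labelProb (fun i => inner ℝ (diffFeature φ (q i)) (cubePoint θ₀ a v τ)) y *
        testError (τ j) (testProb q M (v j) θ₀ y) +
      ∑ y, labelProb (fun i => inner ℝ (diffFeature φ (q i)) (cubePoint θ₀ a v (flipAt j τ))) y *
        testError (!τ j) (testProb q M (v j) θ₀ y))
    (hR : 2 ^ m * R ≤ ∑ τ, ∑ j, w τ j) :
    ∃ τ, ENNReal.ofReal (a ^ 2 * (R / 2)) ≤ estimationError φ q M (cubePoint θ₀ a v τ) := by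
  obtain ⟨τ, hτ⟩ := exists_sum_ge_of_flipAt (fun τ j => ∑ y,
    labelProb (fun i => inner ℝ (diffFeature φ (q i)) (cubePoint θ₀ a v τ)) y *
      testError (τ j) (testProb q M (v j) θ₀ y)) w
    (fun τ j => by simpa only [flipAt_self] using hw τ j) hR
  refine ⟨τ, le_trans (ENNReal.ofReal_le_ofReal ?_)
    (ofReal_sum_testError_le_estimationError hv q M θ₀ ha τ)⟩
  gcongr

/-! ### The statistical bound -/

/-- The statistical lower bound, which holds without privacy. -/
lemma exists_estimationError_ge_statistical {L : ℝ} (hL : 0 < L) (hφ : ∀ s a, ‖φ s a‖ ≤ L)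
    (hn : 0 < n) (hv : Orthonormal ℝ v) (q : Fin n → Query S A)
    (M : RandomizedAlgorithm S A n (EuclideanSpace ℝ (Fin d))) :
    ∃ τ, ENNReal.ofReal ((m : ℝ) ^ 2 / (16 * (n * L ^ 2))) ≤
      estimationError φ q M (cubePoint 0 √(m / (2 * (n * L ^ 2))) v τ) := by
  have hn' : (0 : ℝ) < n := by exact_mod_cast hn
  -- This width makes the squared inner products, summed over samples and coordinates and scaled by
  -- `a ^ 2`, at most `2 * m`. Then half of the total `m / 2` survives, whence `R = m / 4`.
  set a : ℝ := √(m / (2 * (n * L ^ 2)))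
  have ha : 0 ≤ a := Real.sqrt_nonneg _
  have ha2 : a ^ 2 = m / (2 * (n * L ^ 2)) := Real.sq_sqrt (by positivity)
  let x : Fin n → EuclideanSpace ℝ (Fin d) := fun i => diffFeature φ (q i)
  have hs : ∑ j, ∑ i, inner ℝ (x i) (v j) ^ 2 ≤ 4 * (n * L ^ 2) := by
    rw [Finset.sum_comm]
    calc _ ≤ ∑ _i : Fin n, (2 * L) ^ 2 := Finset.sum_le_sum fun i _ =>
          (hv.sum_sq_inner_le (x i)).trans (by gcongr; exact norm_diffFeature_le hφ _)
      _ = _ := by simp; ring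
  obtain ⟨τ, hτ⟩ := exists_estimationError_ge (R := m / 4) (φ := φ) hv q M 0 ha
    (fun _ j => (1 - a ^ 2 * (∑ i, inner ℝ (x i) (v j) ^ 2) / 4) / 2) (fun τ j => by
      refine le_trans ?_ (half_exp_le_sum_testError _ _ (τ j) _ (testProb_nonneg q M (v j) 0)
        (testProb_le_one q M (v j) 0))
      have e : ∑ i, (inner ℝ (x i) (cubePoint 0 a v τ) -
          inner ℝ (x i) (cubePoint 0 a v (flipAt j τ))) ^ 2 =
          4 * a ^ 2 * ∑ i, inner ℝ (x i) (v j) ^ 2 := by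
        rw [Finset.mul_sum]
        refine Finset.sum_congr rfl fun i _ => ?_
        rw [← sq_abs, abs_inner_cubePoint_sub_flipAt _ _ ha, mul_pow, sq_abs]
        ring
      have := Real.add_one_le_exp (-(4 * a ^ 2 * ∑ i, inner ℝ (x i) (v j) ^ 2) / 16)
      simp only [x] at e this ⊢
      rw [e]
      linarith) (by
      rw [Finset.sum_const, Finset.card_univ, Fintype.card_fun, Fintype.card_bool,
        Fintype.card_fin, nsmul_eq_mul]
      push_cast
      refine mul_le_mul_of_nonneg_left ?_ (by positivity)
      rw [← Finset.sum_div, Finset.sum_sub_distrib, ← Finset.sum_div, ← Finset.mul_sum]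
      have h2 : a ^ 2 * ∑ j, ∑ i, inner ℝ (x i) (v j) ^ 2 ≤ 2 * m := by
        calc _ ≤ a ^ 2 * (4 * (n * L ^ 2)) := by gcongr
          _ = _ := by rw [ha2]; field_simp; norm_num
      simp only [Finset.sum_const, Finset.card_univ, Fintype.card_fin, nsmul_eq_mul, mul_one]
      linarith)
  refine ⟨τ, le_of_eq_of_le ?_ hτ⟩
  rw [ha2]
  congr 1
  ring

/-! ### The privacy bound -/

/-- Differential privacy bounds the influence of one label on the probability of an event. -/
lemma CentralLabelDP.measureReal_le {Θ : Type*} [MeasurableSpace Θ]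
    {M : RandomizedAlgorithm S A n Θ} {ε δ : ℝ} (hM : CentralLabelDP M ε δ) (hε : 0 ≤ ε)
    (hδ : 0 ≤ δ) {D D' : Dataset S A n} (h : LabelNeighbors D D') {E : Set Θ}
    (hE : MeasurableSet E) :
    (M D : Measure Θ).real E ≤ (M D' : Measure Θ).real E + 2 * (ε + δ) := by
  have h1 : (M D : Measure Θ).real E ≤ Real.exp ε * (M D' : Measure Θ).real E + δ := by
    have := ENNReal.toReal_mono (by finiteness) (hM D D' h E hE)
    rw [ENNReal.toReal_add (by finiteness) (by finiteness), ENNReal.toReal_mul,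
      ENNReal.toReal_ofReal (Real.exp_pos _).le, ENNReal.toReal_ofReal hδ] at this
    exact this
  have h2 : (M D : Measure Θ).real E ≤ 1 := measureReal_le_one
  have h3 : (M D' : Measure Θ).real E ≤ 1 := measureReal_le_one
  have h4 : 0 ≤ (M D' : Measure Θ).real E := measureReal_nonneg
  -- For `ε ≤ 1` one has `exp ε - 1 ≤ 2 ε`; for `ε ≥ 1` the added term exceeds `1` and the bound is
  -- trivial.
  rcases le_total ε 1 with h5 | h5
  · have h6 := Real.abs_exp_sub_one_le (x := ε) (by rwa [abs_of_nonneg hε])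
    rw [abs_of_nonneg hε] at h6
    have h7 := (abs_le.1 h6).2
    nlinarith
  · linarith

lemma labelNeighbors_update (q : Fin n → Query S A) (y : Fin n → Bool) (i : Fin n) {l : Bool}
    (hl : y i ≠ l) :
    LabelNeighbors (fun k => (q k, y k)) (fun k => (q k, Function.update y i l k)) :=
  ⟨i, rfl, by simpa using hl, fun j hj => by simp [Function.update_of_ne hj]⟩

lemma LabelNeighbors.symm {D D' : Dataset S A n} (h : LabelNeighbors D D') :
    LabelNeighbors D' D := by
  obtain ⟨i, h1, h2, h3⟩ := h
  exact ⟨i, h1.symm, h2.symm, fun j hj => (h3 j hj).symm⟩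

lemma abs_testProb_sub_update_le {M : RandomizedAlgorithm S A n (EuclideanSpace ℝ (Fin d))}
    {ε δ : ℝ} (hM : CentralLabelDP M ε δ) (hε : 0 ≤ ε) (hδ : 0 ≤ δ) (q : Fin n → Query S A)
    (v θ₀ : EuclideanSpace ℝ (Fin d)) (y : Fin n → Bool) (i : Fin n) (l : Bool) :
    |testProb q M v θ₀ y - testProb q M v θ₀ (Function.update y i l)| ≤ 2 * (ε + δ) := by
  by_cases hl : y i = l
  · rw [← hl, Function.update_eq_self, sub_self, abs_zero]
    positivity
  · have h := labelNeighbors_update q y i hl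
    have h1 := hM.measureReal_le hε hδ h (measurableSet_halfSpace v θ₀)
    have h2 := hM.measureReal_le hε hδ h.symm (measurableSet_halfSpace v θ₀)
    simp only [testProb, halfSpaceProb]
    rw [abs_le]
    constructor <;> linarith

/-- The lower bound from privacy, for a hypercube whose flips change few labels. -/
lemma exists_estimationError_ge_private
    {M : RandomizedAlgorithm S A n (EuclideanSpace ℝ (Fin d))} {ε δ : ℝ}
    (hM : CentralLabelDP M ε δ) (hε : 0 ≤ ε) (hδ : 0 ≤ δ) (hεδ : 0 < ε + δ) (hn : 0 < n)
    (hv : Orthonormal ℝ v) (q : Fin n → Query S A) {a : ℝ} (ha : a = 1 / (32 * (n * (ε + δ))))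
    (θ₀ : EuclideanSpace ℝ (Fin d))
    (hθ₀ : ∑ τ, ∑ j, ∑ i,
      |Real.sigmoid (inner ℝ (diffFeature φ (q i)) (cubePoint θ₀ a v τ)) -
        Real.sigmoid (inner ℝ (diffFeature φ (q i)) (cubePoint θ₀ a v (flipAt j τ)))| ≤
      2 ^ m * (8 * a * m * n)) :
    ∃ τ, ENNReal.ofReal (m / (4096 * (n ^ 2 * (ε + δ) ^ 2))) ≤
      estimationError φ q M (cubePoint θ₀ a v τ) := by
  have hn' : (0 : ℝ) < n := by exact_mod_cast hn
  have ha0 : 0 ≤ a := by rw [ha]; positivity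
  obtain ⟨τ, hτ⟩ := exists_estimationError_ge (R := m / 2) (φ := φ) hv q M θ₀ ha0
    (fun τ j => 1 - 2 * (ε + δ) * ∑ i,
      |Real.sigmoid (inner ℝ (diffFeature φ (q i)) (cubePoint θ₀ a v τ)) -
        Real.sigmoid (inner ℝ (diffFeature φ (q i)) (cubePoint θ₀ a v (flipAt j τ)))|)
    (fun τ j => one_sub_le_sum_testError _ _ (τ j) _
      (abs_testProb_sub_update_le hM hε hδ q (v j) θ₀)) (by
      simp_rw [Finset.sum_sub_distrib, ← Finset.mul_sum]
      have h1 := mul_le_mul_of_nonneg_left hθ₀ (by positivity : 0 ≤ 2 * (ε + δ))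
      -- The constant `32` in `a` is chosen so that the stability loss is half of the total `2 ^ m *
      -- m`.
      have h2 : 2 * (ε + δ) * (2 ^ m * (8 * a * m * n)) = 2 ^ m * (m / 2) := by
        rw [ha]; field_simp; norm_num
      simp only [Finset.sum_const, Finset.card_univ, Fintype.card_fun, Fintype.card_bool,
        Fintype.card_fin, nsmul_eq_mul, mul_one]
      push_cast
      linarith)
  refine ⟨τ, le_of_eq_of_le ?_ hτ⟩
  rw [ha]
  congr 1
  generalize ε + δ = α
  ring

/-- Short features: the flips of a hypercube around the origin change few labels. -/
lemma sum_abs_sigmoid_sub_le_of_norm_le (hv : Orthonormal ℝ v) (q : Fin n → Query S A) {a K : ℝ}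
    (ha : 0 ≤ a) (hK : ∀ i, ‖diffFeature φ (q i)‖ ≤ K) (θ₀ : EuclideanSpace ℝ (Fin d)) :
    ∑ τ, ∑ j, ∑ i,
      |Real.sigmoid (inner ℝ (diffFeature φ (q i)) (cubePoint θ₀ a v τ)) -
        Real.sigmoid (inner ℝ (diffFeature φ (q i)) (cubePoint θ₀ a v (flipAt j τ)))| ≤
      2 ^ m * (2 * a * (√m * K) * n) := by
  have h1 : ∀ i, ∑ j, |inner ℝ (diffFeature φ (q i)) (v j)| ≤ √m * K := fun i => by
    have h := sum_abs_le_sqrt_mul_norm (WithLp.toLp 2 fun j => inner ℝ (diffFeature φ (q i)) (v j))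
    refine h.trans (mul_le_mul_of_nonneg_left (le_trans ?_ (hK i)) (Real.sqrt_nonneg _))
    rw [EuclideanSpace.norm_eq]
    refine Real.sqrt_le_iff.2 ⟨norm_nonneg _, ?_⟩
    simpa using hv.sum_sq_inner_le (diffFeature φ (q i))
  have h2 : ∀ τ : Fin m → Bool, ∑ j, ∑ i,
      |Real.sigmoid (inner ℝ (diffFeature φ (q i)) (cubePoint θ₀ a v τ)) -
        Real.sigmoid (inner ℝ (diffFeature φ (q i)) (cubePoint θ₀ a v (flipAt j τ)))| ≤
      2 * a * (√m * K) * n := fun τ => by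
    rw [Finset.sum_comm]
    calc _ ≤ ∑ i, ∑ j, 2 * a * |inner ℝ (diffFeature φ (q i)) (v j)| :=
          Finset.sum_le_sum fun i _ => Finset.sum_le_sum fun j _ =>
            (abs_sigmoid_sub_sigmoid_le _ _).trans
              (abs_inner_cubePoint_sub_flipAt _ _ ha _ _ _).le
      _ ≤ ∑ _i : Fin n, 2 * a * (√m * K) := Finset.sum_le_sum fun i _ => by
          rw [← Finset.mul_sum]
          exact mul_le_mul_of_nonneg_left (h1 i) (by positivity)
      _ = _ := by simp [mul_comm]
  refine (Finset.sum_le_sum fun τ _ => h2 τ).trans ?_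
  simp

/-- A large parameter set: some hypercube has flips that change few labels, whatever the
features are. -/
lemma exists_center_of_one_le (hm : 0 < m) (hn : 0 < n) (hv : Orthonormal ℝ v)
    (q : Fin n → Query S A) {a B : ℝ} (ha : 0 < a) (hB : 1 ≤ B) :
    ∃ g : Fin m → ℝ, ‖∑ j, g j • v j‖ ≤ B / 2 ∧ ∑ τ, ∑ j, ∑ i,
      |Real.sigmoid (inner ℝ (diffFeature φ (q i)) (cubePoint (∑ j, g j • v j) a v τ)) -
        Real.sigmoid (inner ℝ (diffFeature φ (q i))
          (cubePoint (∑ j, g j • v j) a v (flipAt j τ)))| ≤ 2 ^ m * (8 * a * m * n) := by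
  obtain ⟨g, hg1, hg2⟩ := exists_center_sum_abs_sigmoid_sub_le hm hn ha hB
    (fun i => WithLp.toLp 2 fun j => inner ℝ (diffFeature φ (q i)) (v j))
    (fun τ i => a * ∑ j, (if τ j then (1 : ℝ) else -1) * inner ℝ (diffFeature φ (q i)) (v j))
    (fun τ j i => by
      rw [← mul_sub, abs_mul, abs_of_pos ha, abs_sum_sign_sub_flipAt]
      exact le_of_eq (by ring))
  refine ⟨g, ?_, le_of_eq_of_le ?_ hg2⟩
  · rw [hv.norm_sum_smul]
    simpa [EuclideanSpace.norm_eq] using hg1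
  · refine Finset.sum_congr rfl fun τ _ => Finset.sum_congr rfl fun j _ =>
      Finset.sum_congr rfl fun i _ => ?_
    have e : inner ℝ (diffFeature φ (q i)) (∑ j, g j • v j) =
        inner ℝ (WithLp.toLp 2 fun j => inner ℝ (diffFeature φ (q i)) (v j)) g := by
      simp only [inner_sum, real_inner_smul_right]
      simp [PiLp.inner_apply]
    rw [inner_cubePoint, inner_cubePoint, e]

end Estimation

/-! ### Hypercubes inside the parameter set and conclusion -/

/-- An orthonormal basis of the hyperplane of centred vectors. -/
lemma exists_orthonormal_centred {d : ℕ} (hd : 2 ≤ d) :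
    ∃ v : Fin (d - 1) → EuclideanSpace ℝ (Fin d), Orthonormal ℝ v ∧ ∀ j, ∑ k, v j k = 0 := by
  let e : EuclideanSpace ℝ (Fin d) := WithLp.toLp 2 fun _ => 1
  have he : e ≠ 0 := fun h => by
    have := congrArg (fun f : EuclideanSpace ℝ (Fin d) => f ⟨0, by omega⟩) h
    simp [e] at this
  have : Fact (Module.finrank ℝ (EuclideanSpace ℝ (Fin d)) = (d - 1) + 1) :=
    ⟨by rw [finrank_euclideanSpace_fin]; omega⟩
  have hf : Module.finrank ℝ (ℝ ∙ e)ᗮ = d - 1 := Submodule.finrank_orthogonal_span_singleton he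
  let b := (stdOrthonormalBasis ℝ (ℝ ∙ e)ᗮ).reindex (finCongr hf)
  refine ⟨fun j => b j, b.orthonormal.comp_linearIsometry (Submodule.subtypeₗᵢ _), fun j => ?_⟩
  have h := Submodule.mem_orthogonal_singleton_iff_inner_right.1 (b j).2
  simpa [e, PiLp.inner_apply] using h

lemma sum_cubePoint_eq_zero {d m : ℕ} {v : Fin m → EuclideanSpace ℝ (Fin d)}
    (hv : ∀ j, ∑ k, v j k = 0) {θ₀ : EuclideanSpace ℝ (Fin d)} (hθ₀ : ∑ k, θ₀ k = 0) (a : ℝ)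
    (τ : Fin m → Bool) : ∑ k, cubePoint θ₀ a v τ k = 0 := by
  simp only [cubePoint, PiLp.add_apply, PiLp.smul_apply, WithLp.ofLp_sum, Finset.sum_apply,
    Finset.sum_add_distrib, hθ₀, smul_eq_mul, ← Finset.mul_sum]
  rw [Finset.sum_comm]
  simp [hv]

section ParamSet

variable {S A : Type*} {d n : ℕ} {φ : S → A → EuclideanSpace ℝ (Fin d)}
  {v : Fin (d - 1) → EuclideanSpace ℝ (Fin d)} {B : ℝ}

lemma exists_mem_paramSet_statistical (hd : 2 ≤ d) (hB : 0 < B) {L : ℝ} (hL : 0 < L)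
    (hφ : ∀ s a, ‖φ s a‖ ≤ L) (hv : Orthonormal ℝ v) (hv0 : ∀ j, ∑ k, v j k = 0)
    (q : Fin n → Query S A) (hn : (d : ℝ) ^ 2 / (L ^ 2 * B ^ 2) ≤ n) (hn0 : 0 < n)
    (M : RandomizedAlgorithm S A n (EuclideanSpace ℝ (Fin d))) :
    ∃ θ ∈ paramSet d B, ENNReal.ofReal ((d : ℝ) ^ 2 / (n * L ^ 2) / 64) ≤
      estimationError φ q M θ := by
  have hd' : (2 : ℝ) ≤ d := by exact_mod_cast hd
  have hn' : (0 : ℝ) < n := by exact_mod_cast hn0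
  have hmd : ((d - 1 : ℕ) : ℝ) = d - 1 := by rw [Nat.cast_sub (by omega)]; simp
  obtain ⟨τ, hτ⟩ := exists_estimationError_ge_statistical hL hφ hn0 hv q M
  refine ⟨_, ⟨sum_cubePoint_eq_zero hv0 (by simp) _ τ, ?_⟩,
    (ENNReal.ofReal_le_ofReal ?_).trans hτ⟩
  · refine (norm_cubePoint_le hv _ (Real.sqrt_nonneg _) τ).trans ?_
    rw [norm_zero, zero_add, ← Real.sqrt_mul (by positivity)]
    refine Real.sqrt_le_iff.2 ⟨hB.le, ?_⟩
    rw [div_le_iff₀ (by positivity)] at hn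
    rw [div_mul_eq_mul_div, div_le_iff₀ (by positivity), hmd]
    nlinarith
  · rw [div_div, mul_comm _ (64 : ℝ), div_le_div_iff₀ (by positivity) (by positivity), hmd]
    -- Passing from `m = d - 1` to `d` costs a constant factor because `d ≥ 2`.
    have h : (d : ℝ) ^ 2 ≤ 4 * (d - 1) ^ 2 := by nlinarith
    have h2 : (0 : ℝ) ≤ 16 * (n * L ^ 2) := by positivity
    nlinarith [mul_le_mul_of_nonneg_right h h2]

/-- The radius `B` is split in two: the centre uses at most `B / 2`, and so does the half-diagonal
`a √m`, by the lower bound on `n`. -/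
lemma exists_mem_paramSet_private (hd : 2 ≤ d) (hB : 0 < B) {ε δ : ℝ}
    {M : RandomizedAlgorithm S A n (EuclideanSpace ℝ (Fin d))}
    (hM : CentralLabelDP M ε δ) (hε : 0 ≤ ε) (hδ : 0 ≤ δ) (hεδ : 0 < ε + δ)
    (hv : Orthonormal ℝ v) (hv0 : ∀ j, ∑ k, v j k = 0) (q : Fin n → Query S A)
    (hn : √d / (B * (ε + δ)) ≤ n) (hn0 : 0 < n)
    (hcase : 1 ≤ B ∨ ∀ i, ‖diffFeature φ (q i)‖ ≤ √d) :
    ∃ θ ∈ paramSet d B, ENNReal.ofReal (d / (n ^ 2 * (ε + δ) ^ 2) / 8192) ≤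
      estimationError φ q M θ := by
  have hd' : (2 : ℝ) ≤ d := by exact_mod_cast hd
  have hn' : (0 : ℝ) < n := by exact_mod_cast hn0
  have hmd : ((d - 1 : ℕ) : ℝ) = d - 1 := by rw [Nat.cast_sub (by omega)]; simp
  have hsqrt : √((d - 1 : ℕ) : ℝ) ≤ √d := Real.sqrt_le_sqrt (by linarith)
  obtain ⟨a, ha⟩ : ∃ a : ℝ, a = 1 / (32 * (n * (ε + δ))) := ⟨_, rfl⟩
  have ha0 : 0 < a := by rw [ha]; positivity
  obtain ⟨θ₀, h0, hnorm, hsum⟩ : ∃ θ₀ : EuclideanSpace ℝ (Fin d), ∑ k, θ₀ k = 0 ∧ ‖θ₀‖ ≤ B / 2 ∧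
      ∑ τ, ∑ j, ∑ i,
        |Real.sigmoid (inner ℝ (diffFeature φ (q i)) (cubePoint θ₀ a v τ)) -
          Real.sigmoid (inner ℝ (diffFeature φ (q i)) (cubePoint θ₀ a v (flipAt j τ)))| ≤
        2 ^ (d - 1) * (8 * a * (d - 1 : ℕ) * n) := by
    rcases hcase with hB1 | hx
    · obtain ⟨g, hg1, hg2⟩ := exists_center_of_one_le (φ := φ) (by omega) hn0 hv q ha0 hB1
      refine ⟨_, ?_, hg1, hg2⟩
      simp only [WithLp.ofLp_sum, Finset.sum_apply, PiLp.smul_apply, smul_eq_mul]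
      rw [Finset.sum_comm]
      simp [← Finset.mul_sum, hv0]
    · refine ⟨0, by simp, by rw [norm_zero]; positivity,
        (sum_abs_sigmoid_sub_le_of_norm_le hv q ha0.le hx 0).trans ?_⟩
      have h2 : √((d - 1 : ℕ) : ℝ) * √d ≤ 2 * (d - 1 : ℕ) := by
        calc √((d - 1 : ℕ) : ℝ) * √d ≤ √d * √d := by gcongr
          _ = d := Real.mul_self_sqrt (by positivity)
          _ ≤ 2 * (d - 1 : ℕ) := by linarith
      calc _ ≤ 2 ^ (d - 1) * (2 * a * (2 * (d - 1 : ℕ)) * n) := by gcongr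
        _ ≤ _ := by
          have : 0 ≤ 2 ^ (d - 1) * (a * (d - 1 : ℕ) * n) := by positivity
          linarith
  obtain ⟨τ, hτ⟩ := exists_estimationError_ge_private hM hε hδ hεδ hn0 hv q ha θ₀ hsum
  refine ⟨_, ⟨sum_cubePoint_eq_zero hv0 h0 _ τ, ?_⟩, (ENNReal.ofReal_le_ofReal ?_).trans hτ⟩
  · refine (norm_cubePoint_le hv _ ha0.le τ).trans ?_
    have h2 : a * √((d - 1 : ℕ) : ℝ) ≤ B / 2 := by
      rw [div_le_iff₀ (by positivity)] at hn
      rw [ha, div_mul_eq_mul_div, div_le_iff₀ (by positivity)]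
      have : 0 < B * (n * (ε + δ)) := by positivity
      linarith
    linarith
  · rw [div_div, mul_comm _ (8192 : ℝ), div_le_div_iff₀ (by positivity) (by positivity), hmd]
    have h : (d : ℝ) ≤ 2 * (d - 1) := by linarith
    have h2 : (0 : ℝ) ≤ 4096 * (n ^ 2 * (ε + δ) ^ 2) := by positivity
    nlinarith [mul_le_mul_of_nonneg_right h h2]

end ParamSet

theorem mainTheorem5 :
    ∃ c C : ℝ, 0 < c ∧ 0 < C ∧
      ∀ (d n : ℕ) (B L ε δ : ℝ), 2 ≤ d → 0 < B → 0 < L → 0 ≤ ε → 0 ≤ δ → 0 < ε + δ →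
      ∀ (S A : Type*) (φ : S → A → EuclideanSpace ℝ (Fin d)), (∀ s a, ‖φ s a‖ ≤ L) →
      ∀ q : Fin n → Query S A,
        -- the sample size is large enough
        C * ((d : ℝ) ^ 2 / (L ^ 2 * B ^ 2)) ≤ (n : ℝ) →
        C * (Real.sqrt d / (B * (ε + δ))) ≤ (n : ℝ) →
        (1 ≤ B ∨ (∀ i, ‖diffFeature φ (q i)‖ ≤ Real.sqrt d) ∨
          L ^ 2 / (d * (ε + δ) ^ 2) ≤ (n : ℝ)) →
      ∀ M : RandomizedAlgorithm S A n (EuclideanSpace ℝ (Fin d)), CentralLabelDP M ε δ →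
        ∃ θ ∈ paramSet d B,
          ENNReal.ofReal (c * ((d : ℝ) ^ 2 / (n * L ^ 2) + d / (n ^ 2 * (ε + δ) ^ 2))) ≤
            estimationError φ q M θ := by
  -- `16384 = 2 · 8192`: the sum of the two terms is at most twice the larger one.
  refine ⟨1 / 16384, 1, by norm_num, one_pos, ?_⟩
  intro d n B L ε δ hd hB hL hε hδ hεδ S A φ hφ q hn1 hn2 hcase M hM
  rw [one_mul] at hn1 hn2
  have hn' : (0 : ℝ) < n := lt_of_lt_of_le (by positivity) hn1
  have hn : 0 < n := by exact_mod_cast hn'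
  obtain ⟨v, hv, hv0⟩ := exists_orthonormal_centred hd
  have hX : 0 ≤ (d : ℝ) ^ 2 / (n * L ^ 2) := by positivity
  rcases le_total (d / (n ^ 2 * (ε + δ) ^ 2)) ((d : ℝ) ^ 2 / (n * L ^ 2)) with hle | hle
  · obtain ⟨θ, hθ, h⟩ := exists_mem_paramSet_statistical hd hB hL hφ hv hv0 q hn1 hn M
    exact ⟨θ, hθ, (ENNReal.ofReal_le_ofReal (by linarith)).trans h⟩
  rcases or_assoc.2 hcase with hcase | hlarge
  · obtain ⟨θ, hθ, h⟩ :=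
      exists_mem_paramSet_private hd hB hM hε hδ hεδ hv hv0 q hn2 hn hcase
    exact ⟨θ, hθ, (ENNReal.ofReal_le_ofReal (by linarith)).trans h⟩
  · obtain ⟨θ, hθ, h⟩ := exists_mem_paramSet_statistical hd hB hL hφ hv hv0 q hn1 hn M
    refine ⟨θ, hθ, (ENNReal.ofReal_le_ofReal ?_).trans h⟩
    -- In this case the condition on `n` is equivalent to the privacy term being at most the
    -- statistical one.
    have hle' : d / (n ^ 2 * (ε + δ) ^ 2) ≤ (d : ℝ) ^ 2 / (n * L ^ 2) := by
      rw [div_le_iff₀ (by positivity)] at hlarge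
      rw [div_le_div_iff₀ (by positivity) (by positivity)]
      nlinarith [mul_le_mul_of_nonneg_left hlarge (by positivity : (0 : ℝ) ≤ d * n)]
    linarith
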